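/- Let $G$ be a group, $L\ge 1$, and $\mathcal T\in\mathrm{Aut}(G)$ with $\mathcal T^L=\mathrm{id}$. Consider a periodic chain whose sites $j\in\mathbb Z/L$ carry the space $\mathbb C^d$, $d\ge 1$, and unitaries $U_{g,j}$ ($g\in G$) forming projective representations, $U_{g,j}U_{h,j}=\nu_j(g,h)\,U_{gh,j}$ with $\nu_j(g,h)\in U(1)$, and transforming under translation as $U_{g,j}\doteq U_{\mathcal T(g),j-1}$, where $\doteq$ denotes equality up to a phase (which may depend on $g$ and $j$). Then each $\nu_j$ is a 2-cocycle and $\nu_j(g,h)=\nu_{j-1}(\mathcal T(g),\mathcal T(h))$ up to a coboundary $\beta(g)\beta(h)\beta(gh)^{-1}$, $\beta:G\to U(1)$. Let $A=(A^s)_{s=1}^d$ be complex $D\times D$ matrices, $D\ge1$, defining on every chain of $N$ sites the translation-invariant matrix product state $|\psi_N\rangle=\sum_{s_1,\dots,s_N}\mathrm{Tr}(A^{s_1}\cdots A^{s_N})|s_1\cdots s_N\rangle$. Call $A$ injective if the transfer map $\mathbb E(X)=\sum_s A^sX(A^s)^\dagger$ has an eigenvalue $r>0$ with a positive definite eigenvector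 $\rho$, its adjoint $X\mapsto\sum_s (A^s)^\dagger XA^s$ has a positive definite eigenvector for $r$, the $r$-eigenspace of $\mathbb E$ is $\mathbb C\rho$, and every other eigenvalue of $\mathbb E$ has modulus $<r$. Call $A$ left-canonical if $\sum_s (A^s)^\dagger A^s=\mathbb 1$. Call $A$ symmetric if for every $g\in G$ and $k\ge 1$, $\mathcal U_g^{(k)}|\psi_{kL}\rangle=e^{i\theta}|\psi_{kL}\rangle$ for some real $\theta=\theta(g,k)$, where $\mathcal U_g^{(k)}$ is the tensor product over the $kL$ sites of the $L$-periodically repeated unitaries $U_{g,j}$. (i) If $A$ is injective, left-canonical and symmetric, then there are $D\times D$ unitaries $v_j(g)$ on the bonds $j\in\mathbb Z/L$ such that, for all $j,g$, $$\sum_{s'}(U_{g,j})_{ss'}A^{s'}\doteq v_{j-1}(g)^\dagger A^s v_j(g),$$ with a phase independent of $s$. For every such family, $v_j(g)\doteq v_{j-1}(\mathcal T(g))$, and there are 2-cocycles $\omega_j:G\times G\to U(1)$ with $v_j(g)v_j(h)=\omega_j(g,h)v_j(gh)$ such that, for all $j$, up to coboundaries, $$\omega_j(g,h)=\nu_j(g,h)\,\omega_{j-1}(g,h),\qquad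 \omega_j(g,h)=\omega_{j-1}(\mathcal T(g),\mathcal T(h)).$$ (ii) (LSM-type obstruction.) If there is no family of 2-cocycles $\omega_j:G\times G\to U(1)$, $j\in\mathbb Z/L$, satisfying these two equations up to coboundaries for all $j$, then there is no injective symmetric $A$ of any bond dimension $D\ge1$, left-canonical or not. -/

import Mathlib

open scoped Matrix ComplexOrder

namespace ModulatedMPS

/-! ### Cocycles with values in `U(1)` (trivial action) -/

/-- `ω : G × G → U(1)` is a 2-cocycle. -/
def IsTwoCocycle {G : Type*} [Group G] (ω : G → G → Circle) : Prop :=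
  ∀ g h k : G, ω g h * ω (g * h) k = ω h k * ω g (h * k)

/-- `ω` and `ω'` agree up to a coboundary `β(g) β(h) β(gh)⁻¹`. -/
def EqUpToCoboundary {G : Type*} [Group G] (ω ω' : G → G → Circle) : Prop :=
  ∃ β : G → Circle, ∀ g h : G, ω g h = ω' g h * (β g * β h * (β (g * h))⁻¹)

/-! ### Translation-invariant matrix product states

An MPS tensor with physical dimension `d` and bond dimension `D` is a family
`A : Fin d → Matrix (Fin D) (Fin D) ℂ`, the same on every site. -/

/-- The periodic MPS on `N` sites, in the product basis:
`ψ(s₁, …, s_N) = Tr (A^{s₁} ⋯ A^{s_N})`. -/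
def mpsState {d D : ℕ} (A : Fin d → Matrix (Fin D) (Fin D) ℂ) (N : ℕ) :
    (Fin N → Fin d) → ℂ :=
  fun s => ((List.ofFn fun i => A (s i)).prod).trace

/-- The transfer matrix `∑ₛ Aˢ ⊗ (Aˢ)*`, as the linear map `X ↦ ∑ₛ Aˢ X (Aˢ)†`. -/
noncomputable def transferMap {d D : ℕ} (A : Fin d → Matrix (Fin D) (Fin D) ℂ) :
    Module.End ℂ (Matrix (Fin D) (Fin D) ℂ) :=
  ∑ s, LinearMap.mulLeft ℂ (A s) ∘ₗ LinearMap.mulRight ℂ (A s)ᴴ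

/-- Injectivity: the transfer matrix has a dominant eigenvalue `r > 0` with positive definite right
and left eigenvectors `ρ` and `Λ`; the eigenvector is unique up to scalars, and every other
eigenvalue is strictly smaller in modulus. -/
def IsInjective {d D : ℕ} (A : Fin d → Matrix (Fin D) (Fin D) ℂ) : Prop :=
  ∃ r : ℝ, 0 < r ∧ ∃ ρ Λ : Matrix (Fin D) (Fin D) ℂ,
    ρ.PosDef ∧ Λ.PosDef ∧
    transferMap A ρ = (r : ℂ) • ρ ∧
    ∑ s, (A s)ᴴ * Λ * A s = (r : ℂ) • Λ ∧
    ∀ (μ : ℂ) (X : Matrix (Fin D) (Fin D) ℂ), (transferMap A).HasEigenvector μ X →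
      (μ = (r : ℂ) ∧ ∃ c : ℂ, X = c • ρ) ∨ ‖μ‖ < r

/-- Left-canonical form: the identity is a left eigenvector of the transfer matrix with
eigenvalue one. -/
def IsLeftCanonical {d D : ℕ} (A : Fin d → Matrix (Fin D) (Fin D) ℂ) : Prop :=
  ∑ s, (A s)ᴴ * A s = 1

/-! ### On-site symmetries

Sites (and bonds) of the periodic chain of length `L` are labelled by `ZMod L`; bond `j` lies
between the sites `j` and `j + 1`. -/

/-- The operator `W₁ ⊗ ⋯ ⊗ W_N` on `(ℂ^d)^{⊗ N}`, in the product basis. -/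
def tensorOp {d N : ℕ} (W : Fin N → Matrix (Fin d) (Fin d) ℂ) :
    Matrix (Fin N → Fin d) (Fin N → Fin d) ℂ :=
  Matrix.of fun s t => ∏ i, W i (s i) (t i)

/-- The MPS is symmetric: for every `k ≥ 1`, the MPS on `k L` sites is an eigenstate, with an
eigenvalue of modulus one, of the `k`-fold periodic extension of `⨂ⱼ U_{g,j}`. -/
def IsSymmetric {G : Type*} {d D L : ℕ}
    (U : ZMod L → G → Matrix.unitaryGroup (Fin d) ℂ)
    (A : Fin d → Matrix (Fin D) (Fin D) ℂ) : Prop :=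
  ∀ (g : G) (k : ℕ), 0 < k → ∃ θ : Circle,
    tensorOp (fun i : Fin (k * L) => (U ((i : ℕ) : ZMod L) g : Matrix (Fin d) (Fin d) ℂ)) *ᵥ
        mpsState A (k * L)
      = (θ : ℂ) • mpsState A (k * L)

/-- `U` is a projective representation of `G` on every site, with phases `ν`:
`U_{g,j} U_{h,j} = ν_j(g,h) U_{gh,j}`. (Used for the physical sites and for the bonds.) -/
def IsProjectiveRep {G : Type*} [Group G] {n L : ℕ}
    (U : ZMod L → G → Matrix.unitaryGroup (Fin n) ℂ) (ν : ZMod L → G → G → Circle) : Prop :=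
  ∀ (j : ZMod L) (g h : G),
    (U j g * U j h : Matrix (Fin n) (Fin n) ℂ) =
      (ν j g h : ℂ) • (U j (g * h) : Matrix (Fin n) (Fin n) ℂ)

/-- Compatibility with translation, up to phases: `U_{g,j} ≐ U_{T(g),j-1}`. -/
def IsCovariant {G : Type*} [Group G] {n L : ℕ} (T : MulAut G)
    (U : ZMod L → G → Matrix.unitaryGroup (Fin n) ℂ) : Prop :=
  ∀ (j : ZMod L) (g : G), ∃ c : Circle,
    (U j g : Matrix (Fin n) (Fin n) ℂ) = (c : ℂ) • (U (j - 1) (T g) : Matrix (Fin n) (Fin n) ℂ)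

/-- The push-through condition `U_{g,j} · A ≐ v_{j-1}(g)† A v_j(g)`, up to a phase which may depend
on `g` and `j`. -/
def PushThrough {G : Type*} {d D L : ℕ}
    (U : ZMod L → G → Matrix.unitaryGroup (Fin d) ℂ)
    (A : Fin d → Matrix (Fin D) (Fin D) ℂ)
    (v : ZMod L → G → Matrix.unitaryGroup (Fin D) ℂ) : Prop :=
  ∀ (j : ZMod L) (g : G), ∃ c : Circle, ∀ s : Fin d,
    ∑ s', (U j g : Matrix (Fin d) (Fin d) ℂ) s s' • A s' =
      (c : ℂ) • ((v (j - 1) g : Matrix (Fin D) (Fin D) ℂ)ᴴ * A s *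
        (v j g : Matrix (Fin D) (Fin D) ℂ))

/-- The two constraints, up to coboundaries:
`ω_j(g,h) = ν_j(g,h) ω_{j-1}(g,h)` and `ω_j(g,h) = ω_{j-1}(T(g),T(h))`. -/
def SatisfiesConstraints {G : Type*} [Group G] {L : ℕ} (T : MulAut G)
    (ν ω : ZMod L → G → G → Circle) : Prop :=
  ∀ j : ZMod L,
    EqUpToCoboundary (ω j) (fun g h => ν j g h * ω (j - 1) g h) ∧
    EqUpToCoboundary (ω j) (fun g h => ω (j - 1) (T g) (T h))

end ModulatedMPS

/-!
Let `E` be the transfer map of a left-canonical injective tensor `A`, with dominant eigenvalue `1`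
and eigenvector `ρ`. Symmetry equates, up to a phase, the trace of `E ^ (k L)` with the trace of the
`k`-th power of the product, around one unit cell, of the mixed transfer maps between `U_{g,j} · A`
and `A`. The former does not tend to `0`, so the product has an eigenvalue of modulus at least one;
distributing an `L`-th root of it over the sites gives matrices `X_j` with
`∑ₛ (U_{g,j} · A)ˢ X_j (Aˢ)† = κ X_{j-1}` and `1 ≤ ‖κ‖`. Write `X_j = Z_j ρ`. In the norm
`Tr (Z ρ Z†)` the mixed maps are contractions whose defect measures the failure of
`(U_{g,j} · A)ˢ Z_j = κ Z_{j-1} Aˢ`; summing around the cycle forces `‖κ‖ = 1` and every defect to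
vanish. The matrices `Z_j† Z_j` are then permuted cyclically by the adjoint of `E`, hence are a
common multiple of the identity, and `Z_j` can be normalised to be unitary.

Conversely, `L` applications of `E` to `W_j ρ`, where the unitaries `W_j` satisfy
`Aˢ W_j ≐ W_{j-1} Aˢ`, return `W_j ρ` up to a phase; as the dominant eigenvector is unique, `W_j` is
a scalar. So the bond unitaries are determined up to phases by the on-site operators: this gives
covariance, the cocycles and the constraint relating `ω_j` to `ω_{j-1}`. For the obstruction, a
square root of the left eigenvector brings `A` to left-canonical form without losing symmetry.
-/

namespace ModulatedMPS

open Filter Topology Module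

section LinearAlgebra

variable {K V : Type*} [Field K] [AddCommGroup V] [Module K V]

theorem trace_pow_eq_finrank_mul_of_isNilpotent [FiniteDimensional K V] {F : Module.End K V}
    {μ : K} (hF : IsNilpotent (F - algebraMap K _ μ)) (n : ℕ) :
    LinearMap.trace K V (F ^ n) = finrank K V * μ ^ n := by
  induction n with
  | zero => simp
  | succ n ih =>
    rw [pow_succ, End.mul_eq_comp,
      LinearMap.trace_comp_eq_mul_of_commute_of_isNilpotent μ (Commute.pow_self F n) hF, ih]
    ring

theorem maxGenEigenspace_eq_bot {F : Module.End K V} {μ : K} (hμ : ¬ F.HasEigenvalue μ) :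
    F.maxGenEigenspace μ = ⊥ := by
  by_contra h
  exact hμ (End.HasUnifEigenvalue.lt (k := ⊤) one_pos h)

theorem trace_pow_eq_sum_finrank_maxGenEigenspace [IsAlgClosed K] [FiniteDimensional K V]
    (F : Module.End K V) {s : Finset K} (hs : ∀ μ, F.HasEigenvalue μ → μ ∈ s) (n : ℕ) :
    LinearMap.trace K V (F ^ n) = ∑ μ ∈ s, finrank K (F.maxGenEigenspace μ) * μ ^ n := by
  classical
  have hmaps (μ : K) := F.mapsTo_maxGenEigenspace_of_comm (Commute.refl F) μ
  have hmapsPow (μ : K) := F.mapsTo_maxGenEigenspace_of_comm (Commute.self_pow F n) μ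
  have hinternal := DirectSum.isInternal_submodule_of_iSupIndep_of_iSup_eq_top
    F.independent_maxGenEigenspace F.iSup_maxGenEigenspace_eq_top
  have hfinite : {μ | F.maxGenEigenspace μ ≠ ⊥}.Finite :=
    WellFoundedGT.finite_ne_bot_of_iSupIndep F.independent_maxGenEigenspace
  have hrestrict (μ : K) : LinearMap.trace K _ ((F ^ n).restrict (hmapsPow μ)) =
      finrank K (F.maxGenEigenspace μ) * μ ^ n := by
    rw [← trace_pow_eq_finrank_mul_of_isNilpotent (F := F.restrict (hmaps μ))
      (F.isNilpotent_restrict_maxGenEigenspace_sub_algebraMap μ), End.pow_restrict n (hmaps μ)]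
  rw [LinearMap.trace_eq_sum_trace_restrict' hinternal hfinite hmapsPow]
  simp only [hrestrict]
  refine Finset.sum_subset (fun μ hμ => hs μ ?_) fun μ _ hμ => ?_
  · by_contra h
    simp [maxGenEigenspace_eq_bot h] at hμ
  · have hbot : F.maxGenEigenspace μ = ⊥ := by simpa using hμ
    rw [hbot, finrank_bot, Nat.cast_zero, zero_mul]

theorem tendsto_trace_pow {V : Type*} [AddCommGroup V] [Module ℂ V] [FiniteDimensional ℂ V]
    {F : Module.End ℂ V} (hF : ∀ μ, F.HasEigenvalue μ → μ = 1 ∨ ‖μ‖ < 1) :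
    Tendsto (fun n => LinearMap.trace ℂ V (F ^ n)) atTop
      (𝓝 (finrank ℂ (F.maxGenEigenspace 1))) := by
  set s : Finset ℂ := insert 1 F.finite_hasEigenvalue.toFinset
  have hs (μ : ℂ) (hμ : F.HasEigenvalue μ) : μ ∈ s := by simp [s, hμ]
  have hlim (μ : ℂ) (hμ : μ ∈ s) :
      Tendsto (fun n => μ ^ n) atTop (𝓝 (if μ = 1 then 1 else 0)) := by
    split_ifs with h1
    · simp [h1]
    · have hev : F.HasEigenvalue μ := by simpa [s, h1] using hμ
      exact tendsto_pow_atTop_nhds_zero_of_norm_lt_one ((hF μ hev).resolve_left h1)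
  simp only [trace_pow_eq_sum_finrank_maxGenEigenspace F hs]
  convert tendsto_finsetSum s fun μ hμ => (hlim μ hμ).const_mul
    (finrank ℂ (F.maxGenEigenspace μ) : ℂ)
  simp [s]

theorem tendsto_trace_pow_zero {V : Type*} [AddCommGroup V] [Module ℂ V] [FiniteDimensional ℂ V]
    {F : Module.End ℂ V} (hF : ∀ μ, F.HasEigenvalue μ → ‖μ‖ < 1) :
    Tendsto (fun n => LinearMap.trace ℂ V (F ^ n)) atTop (𝓝 0) := by
  have hone : F.maxGenEigenspace 1 = ⊥ :=
    maxGenEigenspace_eq_bot fun h => (hF 1 h).ne norm_one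
  have h := tendsto_trace_pow fun μ hμ => Or.inr (hF μ hμ)
  rwa [hone, finrank_bot, Nat.cast_zero] at h

theorem eq_zero_of_aeval_apply_eq_zero [IsAlgClosed K] [FiniteDimensional K V]
    {F : Module.End K V} {p : Polynomial K} (hp : ∀ μ, F.HasEigenvalue μ → p.eval μ ≠ 0) {x : V}
    (hx : Polynomial.aeval F p x = 0) : x = 0 := by
  by_contra hx0
  have : Nontrivial V := ⟨x, 0, hx0⟩
  have hmem : 0 ∈ spectrum K (Polynomial.aeval F p) :=
    (End.hasEigenvalue_of_hasEigenvector
      ⟨End.mem_eigenspace_iff.2 (by rw [hx, zero_smul]), hx0⟩).mem_spectrum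
  rw [spectrum.map_polynomial_aeval_of_nonempty F p
    (spectrum.nonempty_of_isAlgClosed_of_finiteDimensional K F)] at hmem
  obtain ⟨μ, hμ, hpμ⟩ := hmem
  exact hp μ (End.hasEigenvalue_iff_mem_spectrum.2 hμ) hpμ

open Polynomial in
theorem apply_eq_smul_of_pow_apply_eq_pow_smul [IsAlgClosed K] [FiniteDimensional K V]
    {F : Module.End K V} {r : K} {n : ℕ} (hr : n * r ^ (n - 1) ≠ 0)
    (hF : ∀ μ, F.HasEigenvalue μ → μ ^ n = r ^ n → μ = r) {x : V} (hx : (F ^ n) x = r ^ n • x) :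
    F x = r • x := by
  -- `Xⁿ - rⁿ = p * (X - r)`, and no eigenvalue of `F` is a root of `p`
  set p : K[X] := ∑ i ∈ Finset.range n, X ^ i * C r ^ (n - 1 - i)
  have hp : p * (X - C r) = X ^ n - C (r ^ n) := by
    rw [C_pow, geom_sum₂_mul]
  have hroot (μ : K) (hμ : F.HasEigenvalue μ) (hpμ : p.eval μ = 0) : False := by
    have hpow : μ ^ n = r ^ n := by
      simpa [hpμ, -map_pow, eq_comm, sub_eq_zero] using congrArg (eval μ) hp
    rw [hF μ hμ hpow] at hpμ
    exact hr (by simpa [p, eval_finsetSum, geom_sum₂_self] using hpμ)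
  refine sub_eq_zero.1 (eq_zero_of_aeval_apply_eq_zero hroot ?_)
  calc aeval F p (F x - r • x) = aeval F (p * (X - C r)) x := by simp
    _ = 0 := by rw [hp, map_sub, aeval_X_pow, aeval_C]; simp [hx, -map_pow]

theorem apply_eq_smul_of_pow_apply_eq_smul {V : Type*} [AddCommGroup V] [Module ℂ V]
    [FiniteDimensional ℂ V] {F : Module.End ℂ V} {r : ℝ} (hr : 0 < r)
    (hF : ∀ μ, F.HasEigenvalue μ → ‖μ‖ = r → μ = r) {n : ℕ} (hn : 0 < n) {κ : ℂ}
    (hκ : ‖κ‖ = r ^ n) {x : V} (hx : (F ^ n) x = κ • x) : F x = (r : ℂ) • x := by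
  obtain rfl | hx0 := eq_or_ne x 0
  · simp
  have hroot (μ : ℂ) (hμ : F.HasEigenvalue μ) (hμn : ‖μ ^ n‖ = r ^ n) : μ = r :=
    hF μ hμ ((pow_left_inj₀ (norm_nonneg μ) hr.le hn.ne').1 (by rw [← norm_pow, hμn]))
  have hmem : κ ∈ spectrum ℂ (F ^ n) :=
    (End.hasEigenvalue_of_hasEigenvector ⟨End.mem_eigenspace_iff.2 hx, hx0⟩).mem_spectrum
  rw [spectrum.map_pow_of_pos F hn] at hmem
  obtain ⟨μ, hμ, rfl⟩ := hmem
  obtain rfl := hroot μ (End.hasEigenvalue_iff_mem_spectrum.2 hμ) hκ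
  refine apply_eq_smul_of_pow_apply_eq_pow_smul (by simp [hn.ne', hr.ne']) (fun μ hμ hμr => ?_) hx
  exact hroot μ hμ (by rw [hμr]; exact hκ)

theorem exists_eq_smul_of_comp_eq [FiniteDimensional K V] {F : Module.End K V} {ρ : V}
    (hF : ∀ x, F x = x → ∃ c : K, x = c • ρ) {τ φ : Module.Dual K V} (hτ0 : τ ≠ 0)
    (hτ : τ ∘ₗ F = τ) (hφ : φ ∘ₗ F = φ) : ∃ c : K, φ = c • τ := by
  have hker {ψ : Module.Dual K V} (hψ : ψ ∘ₗ F = ψ) :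
      LinearMap.range (F - 1) ≤ LinearMap.ker ψ := by
    rintro _ ⟨x, rfl⟩
    simpa [sub_eq_zero] using LinearMap.congr_fun hψ x
  have hfixed : LinearMap.ker (F - 1) ≤ Submodule.span K {ρ} := fun x hx => by
    obtain ⟨c, rfl⟩ := hF x (by simpa [sub_eq_zero] using hx)
    exact Submodule.smul_mem _ c (Submodule.mem_span_singleton_self ρ)
  have hrange : LinearMap.range (F - 1) = LinearMap.ker τ := by
    refine Submodule.eq_of_le_of_finrank_le (hker hτ) ?_
    have hrank := LinearMap.finrank_range_add_finrank_ker (F - 1)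
    have hcorank := Module.Dual.finrank_ker_add_one_of_ne_zero hτ0
    have hspan : finrank K (Submodule.span K {ρ}) ≤ 1 := by
      simpa using finrank_span_le_card (R := K) {ρ}
    have := Submodule.finrank_mono hfixed
    omega
  have hmem : φ ∈ Submodule.span K (Set.range fun _ : Unit => τ) :=
    mem_span_of_iInf_ker_le_ker (by simpa [hrange] using hker hφ)
  rw [Set.range_const, Submodule.mem_span_singleton] at hmem
  exact hmem.imp fun c hc => hc.symm

/-- The ordered product `f 0 * f 1 * ⋯ * f (L - 1)` over one period. -/
def cycleProd {M : Type*} [Monoid M] {L : ℕ} (f : ZMod L → M) : M :=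
  ((List.range L).map fun m : ℕ => f m).prod

theorem exists_cyclic_eigenvectors {L : ℕ} [NeZero L] (f : ZMod L → Module.End K V) {κ : K}
    (hκ : κ ≠ 0) (hf : (cycleProd f).HasEigenvalue (κ ^ L)) :
    ∃ x : ZMod L → V, (∀ j, x j ≠ 0) ∧ ∀ j, f j (x j) = κ • x (j - 1) := by
  obtain ⟨x₀, hx₀⟩ := hf.exists_hasEigenvector
  rw [cycleProd] at hx₀
  set l := (List.range L).map fun m : ℕ => f m
  have hlength : l.length = L := by simp [l]
  let y (m : ℕ) : V := κ ^ m • (l.drop m).prod x₀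
  have hy0 (m : ℕ) : y m ≠ 0 := fun h => hx₀.2 <| by
    have hdrop : (l.drop m).prod x₀ = 0 := (smul_eq_zero_iff_right (pow_ne_zero m hκ)).1 h
    have hprod := hx₀.apply_eq_smul
    rw [← List.prod_take_mul_prod_drop l m, End.mul_apply, hdrop, map_zero] at hprod
    exact (smul_eq_zero_iff_right (pow_ne_zero L hκ)).1 hprod.symm
  have hperiod : y L = y 0 := by
    simp only [y, ← hlength, List.drop_length]
    simpa [hlength] using hx₀.apply_eq_smul.symm
  have hstep (m : ℕ) (hm : m < L) : f m (y (m + 1)) = κ • y m := by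
    simp only [y, List.drop_eq_getElem_cons (hm.trans_eq hlength.symm), map_smul, smul_smul,
      pow_succ', List.prod_cons, End.mul_apply]
    simp [l]
  refine ⟨fun j => y (j.val + 1), fun j => hy0 _, fun j => ?_⟩
  have hval : y j.val = y ((j - 1).val + 1) := by
    obtain ⟨i, rfl⟩ : ∃ i, j = i + 1 := ⟨j - 1, by ring⟩
    rw [add_sub_cancel_right, ZMod.val_add, ZMod.val_one_eq_one_mod, Nat.add_mod_mod]
    obtain h | h := (Nat.succ_le_of_lt i.val_lt).eq_or_lt
    · rw [Nat.succ_eq_add_one] at h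
      rw [h, Nat.mod_self, hperiod]
    · rw [Nat.mod_eq_of_lt h]
  simpa [hval] using hstep j.val j.val_lt

end LinearAlgebra

section WeightedNorm

variable {m n : Type*} [Fintype m] [Fintype n]

/-- The squared norm `Tr (Z ρ Z†)` of a matrix, weighted by a positive (semi)definite `ρ`. Transfer
maps of left-canonical tensors contract it. -/
noncomputable def weightedNormSq (ρ : Matrix n n ℂ) (Z : Matrix m n ℂ) : ℝ :=
  (Z * ρ * Zᴴ).trace.re

theorem weightedNormSq_nonneg {ρ : Matrix n n ℂ} (hρ : ρ.PosSemidef) (Z : Matrix m n ℂ) :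
    0 ≤ weightedNormSq ρ Z :=
  (Complex.nonneg_iff.1 (hρ.mul_mul_conjTranspose_same Z).trace_nonneg).1

theorem weightedNormSq_eq_zero {ρ : Matrix n n ℂ} (hρ : ρ.PosDef) {Z : Matrix m n ℂ} :
    weightedNormSq ρ Z = 0 ↔ Z = 0 := by
  refine ⟨fun h => ?_, fun h => by simp [weightedNormSq, h]⟩
  have hpos := hρ.posSemidef.mul_mul_conjTranspose_same Z
  have him := (Complex.nonneg_iff.1 hpos.trace_nonneg).2
  have hzero := hpos.trace_eq_zero_iff.1 (Complex.ext h him.symm)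
  by_contra hZ
  obtain ⟨i, hi⟩ : ∃ i, Z i ≠ 0 := Function.ne_iff.1 hZ
  have hrow : star (star (Z i)) ⬝ᵥ (ρ *ᵥ star (Z i)) = (Z * ρ * Zᴴ) i i := by
    rw [Matrix.mul_assoc, star_star]
    rfl
  exact (hρ.dotProduct_mulVec_pos (star_ne_zero.2 hi)).ne' (by rw [hrow, hzero]; rfl)

theorem weightedNormSq_smul (ρ : Matrix n n ℂ) (c : ℂ) (Z : Matrix m n ℂ) :
    weightedNormSq ρ (c • Z) = ‖c‖ ^ 2 * weightedNormSq ρ Z := by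
  rw [weightedNormSq, Matrix.conjTranspose_smul, Matrix.smul_mul, Matrix.smul_mul, Matrix.mul_smul,
    smul_smul, Matrix.trace_smul, smul_eq_mul, Complex.star_def, Complex.mul_conj',
    ← Complex.ofReal_pow, Complex.re_ofReal_mul, weightedNormSq]

theorem weightedNormSq_sub {ρ : Matrix n n ℂ} (hρ : ρ.IsHermitian) (Y Z : Matrix m n ℂ) :
    weightedNormSq ρ (Y - Z) =
      weightedNormSq ρ Y + weightedNormSq ρ Z - 2 * (Y * ρ * Zᴴ).trace.re := by
  have hcross : (Z * ρ * Yᴴ).trace.re = (Y * ρ * Zᴴ).trace.re := by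
    rw [← Complex.conj_re, ← Complex.star_def, ← Matrix.trace_conjTranspose]
    simp only [Matrix.conjTranspose_mul, Matrix.conjTranspose_conjTranspose, hρ.eq,
      Matrix.mul_assoc]
  simp only [weightedNormSq, Matrix.conjTranspose_sub, Matrix.sub_mul, Matrix.mul_sub,
    Matrix.trace_sub, Complex.sub_re, hcross]
  ring

end WeightedNorm

/-- Tensors with physical dimension `d` and bond dimension `D`. -/
abbrev MPSTensor (d D : ℕ) := Fin d → Matrix (Fin D) (Fin D) ℂ

section TransferMap

variable {d D D' : ℕ}

/-- The mixed transfer map `X ↦ ∑ₛ Bˢ X (Aˢ)†` of two tensors: the trace of its `N`-th power is the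
overlap of their states on `N` sites. -/
noncomputable def mixedMap (B : MPSTensor d D') (A : MPSTensor d D) :
    Module.End ℂ (Matrix (Fin D') (Fin D) ℂ) :=
  ∑ s, mulLeftLinearMap (Fin D) ℂ (B s) ∘ₗ mulRightLinearMap (Fin D') ℂ (A s)ᴴ

theorem mixedMap_apply (B : MPSTensor d D') (A : MPSTensor d D) (X : Matrix (Fin D') (Fin D) ℂ) :
    mixedMap B A X = ∑ s, B s * X * (A s)ᴴ := by
  simp [mixedMap, Matrix.mul_assoc]

theorem transferMap_eq_mixedMap (A : MPSTensor d D) : transferMap A = mixedMap A A := rfl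

theorem transferMap_apply (A : MPSTensor d D) (X : Matrix (Fin D) (Fin D) ℂ) :
    transferMap A X = ∑ s, A s * X * (A s)ᴴ := by
  rw [transferMap_eq_mixedMap, mixedMap_apply]

theorem trace_mul_transferMap (A : MPSTensor d D) (K X : Matrix (Fin D) (Fin D) ℂ) :
    (K * transferMap A X).trace = ((∑ s, (A s)ᴴ * K * A s) * X).trace := by
  rw [transferMap_apply, Matrix.mul_sum, Matrix.sum_mul, Matrix.trace_sum, Matrix.trace_sum]
  refine Finset.sum_congr rfl fun s _ => ?_
  rw [← Matrix.mul_assoc, Matrix.trace_mul_comm]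
  simp only [Matrix.mul_assoc]

theorem trace_mul_transferMap_pow {ι : Type*} [AddCommMonoidWithOne ι] {A : MPSTensor d D}
    {K : ι → Matrix (Fin D) (Fin D) ℂ} (hK : ∀ j, ∑ s, (A s)ᴴ * K j * A s = K (j + 1)) (n : ℕ)
    (j : ι) (X : Matrix (Fin D) (Fin D) ℂ) :
    (K j * (transferMap A ^ n) X).trace = (K (j + n) * X).trace := by
  induction n generalizing j with
  | zero => simp
  | succ n ih =>
    rw [pow_succ', End.mul_apply, trace_mul_transferMap, hK, ih, Nat.cast_succ, add_assoc,
      add_comm (1 : ι)]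

theorem IsLeftCanonical.trace_transferMap {A : MPSTensor d D} (hA : IsLeftCanonical A)
    (X : Matrix (Fin D) (Fin D) ℂ) : (transferMap A X).trace = X.trace := by
  rw [IsLeftCanonical] at hA
  simpa only [Matrix.mul_one, hA, Matrix.one_mul] using trace_mul_transferMap A 1 X

theorem IsLeftCanonical.sum_weightedNormSq_mul {B : MPSTensor d D'} (hB : IsLeftCanonical B)
    (ρ : Matrix (Fin D) (Fin D) ℂ) (Z : Matrix (Fin D') (Fin D) ℂ) :
    ∑ s, weightedNormSq ρ (B s * Z) = weightedNormSq ρ Z := by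
  rw [weightedNormSq, ← hB.trace_transferMap, transferMap_apply]
  simp only [weightedNormSq, ← Complex.re_sum, Matrix.trace_sum, Matrix.conjTranspose_mul,
    Matrix.mul_assoc]

theorem sum_weightedNormSq_mul_of_transferMap_eq {A : MPSTensor d D} {ρ : Matrix (Fin D) (Fin D) ℂ}
    (hfix : transferMap A ρ = ρ) (Y : Matrix (Fin D') (Fin D) ℂ) :
    ∑ s, weightedNormSq ρ (Y * A s) = weightedNormSq ρ Y := by
  conv_rhs => rw [weightedNormSq, ← hfix, transferMap_apply]
  simp only [weightedNormSq, ← Complex.re_sum, Matrix.mul_sum, Matrix.sum_mul, Matrix.trace_sum,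
    Matrix.conjTranspose_mul, Matrix.mul_assoc]

theorem IsLeftCanonical.sum_weightedNormSq_mul_sub_mul {B : MPSTensor d D'}
    (hB : IsLeftCanonical B) {A : MPSTensor d D} {ρ : Matrix (Fin D) (Fin D) ℂ}
    (hρ : ρ.IsHermitian) (hfix : transferMap A ρ = ρ) {Y Z : Matrix (Fin D') (Fin D) ℂ}
    (hY : mixedMap B A (Z * ρ) = Y * ρ) :
    ∑ s, weightedNormSq ρ (B s * Z - Y * A s) = weightedNormSq ρ Z - weightedNormSq ρ Y := by
  have hcross : ∑ s, (B s * Z * ρ * (Y * A s)ᴴ).trace.re = weightedNormSq ρ Y := by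
    rw [weightedNormSq, ← hY, mixedMap_apply]
    simp only [← Complex.re_sum, Matrix.sum_mul, Matrix.trace_sum, Matrix.conjTranspose_mul,
      Matrix.mul_assoc]
  simp only [weightedNormSq_sub hρ, Finset.sum_sub_distrib, Finset.sum_add_distrib,
    ← Finset.mul_sum, hB.sum_weightedNormSq_mul, sum_weightedNormSq_mul_of_transferMap_eq hfix,
    hcross]
  ring

end TransferMap

section DominantEigenpair

variable {d D : ℕ} {A : MPSTensor d D} {r : ℝ} {ρ : Matrix (Fin D) (Fin D) ℂ}

/-- `r > 0` is the dominant eigenvalue of the transfer map of `A`, with eigenspace spanned by the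
positive definite matrix `ρ`: the half of `IsInjective` that concerns right eigenvectors. -/
structure IsDominantEigenpair (A : MPSTensor d D) (r : ℝ) (ρ : Matrix (Fin D) (Fin D) ℂ) :
    Prop where
  pos : 0 < r
  posDef : ρ.PosDef
  apply_eq : transferMap A ρ = (r : ℂ) • ρ
  dominant : ∀ (μ : ℂ) (X : Matrix (Fin D) (Fin D) ℂ), (transferMap A).HasEigenvector μ X →
    (μ = (r : ℂ) ∧ ∃ c : ℂ, X = c • ρ) ∨ ‖μ‖ < r

theorem IsInjective.exists_isDominantEigenpair (hA : IsInjective A) :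
    ∃ r ρ, IsDominantEigenpair A r ρ := by
  obtain ⟨r, hr, ρ, -, hρ, -, hfix, -, hdom⟩ := hA
  exact ⟨r, ρ, hr, hρ, hfix, hdom⟩

namespace IsDominantEigenpair

theorem eq_or_norm_lt (h : IsDominantEigenpair A r ρ) {μ : ℂ}
    (hμ : (transferMap A).HasEigenvalue μ) : μ = r ∨ ‖μ‖ < r := by
  obtain ⟨X, hX⟩ := hμ.exists_hasEigenvector
  exact (h.dominant μ X hX).imp_left And.left

theorem exists_eq_smul (h : IsDominantEigenpair A r ρ) {X : Matrix (Fin D) (Fin D) ℂ}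
    (hX : transferMap A X = (r : ℂ) • X) : ∃ c : ℂ, X = c • ρ := by
  obtain rfl | hX0 := eq_or_ne X 0
  · exact ⟨0, (zero_smul ℂ ρ).symm⟩
  obtain ⟨-, hc⟩ | hlt := h.dominant r X ⟨End.mem_eigenspace_iff.2 hX, hX0⟩
  · exact hc
  · exact absurd hlt (by simp [abs_of_pos h.pos])

theorem exists_eq_smul_of_pow_apply_eq (h : IsDominantEigenpair A r ρ) {n : ℕ} (hn : 0 < n)
    {κ : ℂ} (hκ : ‖κ‖ = r ^ n) {X : Matrix (Fin D) (Fin D) ℂ}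
    (hX : (transferMap A ^ n) X = κ • X) : ∃ c : ℂ, X = c • ρ :=
  h.exists_eq_smul <| apply_eq_smul_of_pow_apply_eq_smul h.pos
    (fun _ hμ hμr => (h.eq_or_norm_lt hμ).resolve_right hμr.not_lt) hn hκ hX

variable [NeZero D]

theorem eq_one (h : IsDominantEigenpair A r ρ) (hA : IsLeftCanonical A) : r = 1 := by
  have htrace := hA.trace_transferMap ρ
  rw [h.apply_eq, Matrix.trace_smul, smul_eq_mul,
    mul_eq_right₀ h.posDef.trace_pos.ne'] at htrace
  exact_mod_cast htrace

theorem transferMap_eq (h : IsDominantEigenpair A r ρ) (hA : IsLeftCanonical A) :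
    transferMap A ρ = ρ := by
  rw [h.apply_eq, h.eq_one hA, Complex.ofReal_one, one_smul]

theorem exists_tendsto_trace_pow (h : IsDominantEigenpair A r ρ) (hA : IsLeftCanonical A) :
    ∃ t ≠ 0, Tendsto (fun n => LinearMap.trace ℂ _ (transferMap A ^ n)) atTop (𝓝 t) := by
  have hρ : ρ ∈ (transferMap A).maxGenEigenspace 1 := by
    refine (End.mem_maxGenEigenspace _ _ _).2 ⟨1, ?_⟩
    simp [h.transferMap_eq hA]
  have hρ0 : ρ ≠ 0 := fun h0 => h.posDef.trace_pos.ne' (by rw [h0, Matrix.trace_zero])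
  refine ⟨_, Nat.cast_ne_zero.2 fun hfinrank => hρ0 ?_, tendsto_trace_pow fun μ hμ => ?_⟩
  · rwa [Submodule.finrank_eq_zero.1 hfinrank, Submodule.mem_bot] at hρ
  · simpa [h.eq_one hA] using h.eq_or_norm_lt hμ

/-- The cyclic condition makes the functional `X ↦ Tr (K 0 * X)` invariant under the `L`-th power of
the transfer map, and the invariant functionals are the multiples of the trace. -/
theorem exists_forall_eq_smul_one {L : ℕ} [NeZero L] (h : IsDominantEigenpair A r ρ)
    (hA : IsLeftCanonical A) {K : ZMod L → Matrix (Fin D) (Fin D) ℂ}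
    (hK : ∀ j, ∑ s, (A s)ᴴ * K (j - 1) * A s = K j) : ∃ t : ℂ, ∀ j, K j = t • 1 := by
  have hsucc (j : ZMod L) : ∑ s, (A s)ᴴ * K j * A s = K (j + 1) := by
    simpa only [add_sub_cancel_right] using hK (j + 1)
  let τ (M : Matrix (Fin D) (Fin D) ℂ) : Dual ℂ (Matrix (Fin D) (Fin D) ℂ) :=
    Matrix.traceLinearMap (Fin D) ℂ ℂ ∘ₗ LinearMap.mulLeft ℂ M
  obtain ⟨t, ht⟩ : ∃ t : ℂ, τ (K 0) = t • τ 1 := by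
    refine exists_eq_smul_of_comp_eq (F := transferMap A ^ L) (ρ := ρ) (fun X hX => ?_) ?_ ?_ ?_
    · exact h.exists_eq_smul_of_pow_apply_eq (NeZero.pos L) (κ := 1) (by simp [h.eq_one hA])
        (by rw [hX, one_smul])
    · exact fun h0 => NeZero.ne (D : ℂ) (by simpa [τ] using LinearMap.congr_fun h0 1)
    · refine LinearMap.ext fun X =>
        trace_mul_transferMap_pow (K := fun _ : ZMod L => 1) (fun _ => ?_) L 0 X
      simp only [Matrix.mul_one]
      exact hA
    · refine LinearMap.ext fun X => (trace_mul_transferMap_pow hsucc L 0 X).trans ?_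
      rw [ZMod.natCast_self, add_zero]
      rfl
  refine ⟨t, fun j => ?_⟩
  obtain ⟨n, rfl⟩ := ZMod.natCast_zmod_surjective j
  induction n with
  | zero =>
    refine Matrix.ext_iff_trace_mul_right.2 fun X => ?_
    simpa [τ] using LinearMap.congr_fun ht X
  | succ n ih =>
    rw [Nat.cast_succ, ← hsucc, ih]
    simp only [Matrix.mul_smul, Matrix.smul_mul, Matrix.mul_one, ← Finset.smul_sum]
    rw [hA]

end IsDominantEigenpair

end DominantEigenpair

section Intertwiners

variable {d D D' L : ℕ} {A : MPSTensor d D} {B : ZMod L → MPSTensor d D'} {κ : ℂ}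
  {z : ZMod L → Matrix (Fin D') (Fin D) ℂ}

/-- The mixed transfer maps contract the weighted norm and the defect of the contraction measures
the failure of `z` to intertwine. Around the cycle the norms return to their initial values, so an
eigenvalue `κ` with `1 ≤ ‖κ‖` leaves no room for a defect. -/
theorem norm_eq_one_and_intertwines [NeZero L] {ρ : Matrix (Fin D) (Fin D) ℂ} (hρ : ρ.PosDef)
    (hfix : transferMap A ρ = ρ) (hB : ∀ j, IsLeftCanonical (B j)) (hκ : 1 ≤ ‖κ‖)
    (hz0 : ∃ j, z j ≠ 0) (hz : ∀ j, mixedMap (B j) A (z j * ρ) = κ • (z (j - 1) * ρ)) :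
    ‖κ‖ = 1 ∧ ∀ j s, B j s * z j = κ • (z (j - 1) * A s) := by
  let defect (j : ZMod L) (s : Fin d) : ℝ :=
    weightedNormSq ρ (B j s * z j - (κ • z (j - 1)) * A s)
  have hnonneg (j : ZMod L) (s : Fin d) : 0 ≤ defect j s := weightedNormSq_nonneg hρ.posSemidef _
  have htotal : ∑ j, ∑ s, defect j s = (1 - ‖κ‖ ^ 2) * ∑ j, weightedNormSq ρ (z j) := by
    have hshift : ∑ j, weightedNormSq ρ (z (j - 1)) = ∑ j, weightedNormSq ρ (z j) :=
      (Equiv.subRight (1 : ZMod L)).sum_comp fun j => weightedNormSq ρ (z j)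
    have hsite (j : ZMod L) : ∑ s, defect j s =
        weightedNormSq ρ (z j) - ‖κ‖ ^ 2 * weightedNormSq ρ (z (j - 1)) := by
      rw [← weightedNormSq_smul]
      exact (hB j).sum_weightedNormSq_mul_sub_mul hρ.isHermitian hfix
        (by rw [hz, Matrix.smul_mul])
    simp only [hsite, Finset.sum_sub_distrib, ← Finset.mul_sum, hshift]
    ring
  have hpos : 0 < ∑ j, weightedNormSq ρ (z j) := by
    refine Finset.sum_pos' (fun j _ => weightedNormSq_nonneg hρ.posSemidef _) ?_
    obtain ⟨j, hj⟩ := hz0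
    exact ⟨j, Finset.mem_univ j, (weightedNormSq_nonneg hρ.posSemidef _).lt_of_ne'
      ((weightedNormSq_eq_zero hρ).not.2 hj)⟩
  have hκ1 : ‖κ‖ = 1 := by
    have hfactor : 0 ≤ 1 - ‖κ‖ ^ 2 := nonneg_of_mul_nonneg_left
      (htotal ▸ Finset.sum_nonneg fun j _ => Finset.sum_nonneg fun s _ => hnonneg j s) hpos
    nlinarith
  refine ⟨hκ1, fun j s => ?_⟩
  rw [hκ1, one_pow, sub_self, zero_mul, Fintype.sum_eq_zero_iff_of_nonneg
    fun j => Finset.sum_nonneg fun s _ => hnonneg j s] at htotal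
  have hsite := (Fintype.sum_eq_zero_iff_of_nonneg (hnonneg j)).1 (congrFun htotal j)
  rw [← Matrix.smul_mul]
  exact sub_eq_zero.1 ((weightedNormSq_eq_zero hρ).1 (congrFun hsite s))

theorem sum_conjTranspose_mul_gram_mul {Y Z : Matrix (Fin D') (Fin D) ℂ} {B : MPSTensor d D'}
    (hB : IsLeftCanonical B) (hκ : ‖κ‖ = 1) (hz : ∀ s, B s * Z = κ • (Y * A s)) :
    ∑ s, (A s)ᴴ * (Yᴴ * Y) * A s = Zᴴ * Z := by
  have hterm (s : Fin d) : (A s)ᴴ * (Yᴴ * Y) * A s = Zᴴ * ((B s)ᴴ * B s) * Z := by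
    have hκκ : κ * star κ = 1 := by simp [Complex.mul_conj', hκ]
    have h := congrArg (fun M => Mᴴ * M) (hz s)
    simp only [Matrix.conjTranspose_smul, Matrix.smul_mul, Matrix.mul_smul, smul_smul, hκκ,
      one_smul, Matrix.conjTranspose_mul, Matrix.mul_assoc] at h
    simpa only [Matrix.mul_assoc] using h.symm
  rw [IsLeftCanonical] at hB
  simp only [hterm, ← Matrix.mul_sum, ← Matrix.sum_mul, hB, Matrix.mul_one]

theorem exists_smul_isometry_of_gram_eq {ι m n : Type*} [Fintype m] [Finite n] [DecidableEq n]
    {z : ι → Matrix m n ℂ} (hz0 : ∃ j, z j ≠ 0) {t : ℂ} (ht : ∀ j, (z j)ᴴ * z j = t • 1) :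
    ∃ a : ℂ, ∀ j, (a • z j)ᴴ * (a • z j) = 1 := by
  obtain ⟨j₀, hj₀⟩ := hz0
  have ht0 : t ≠ 0 := by
    rintro rfl
    exact hj₀ (Matrix.conjTranspose_mul_self_eq_zero.1 (by rw [ht, zero_smul]))
  obtain ⟨k, -⟩ := Function.ne_iff.1 (fun h0 => hj₀ (Matrix.transpose_eq_zero.1 h0) : (z j₀)ᵀ ≠ 0)
  have htpos : 0 < t := by
    have hdiag := (Matrix.posSemidef_conjTranspose_mul_self (z j₀)).diag_nonneg (i := k)
    rw [ht, Matrix.smul_apply, Matrix.one_apply_eq, smul_eq_mul, mul_one] at hdiag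
    exact hdiag.lt_of_ne' ht0
  obtain ⟨r, hr, rfl⟩ : ∃ r : ℝ, 0 < r ∧ (r : ℂ) = t := RCLike.pos_iff_exists_ofReal.1 htpos
  refine ⟨((√r)⁻¹ : ℝ), fun j => ?_⟩
  have hsq : (√r)⁻¹ * (√r)⁻¹ * r = 1 := by
    rw [← mul_inv, Real.mul_self_sqrt hr.le, inv_mul_cancel₀ hr.ne']
  rw [Matrix.conjTranspose_smul, Matrix.smul_mul, Matrix.mul_smul, ht, smul_smul, smul_smul,
    Complex.star_def, Complex.conj_ofReal]
  convert one_smul ℂ (1 : Matrix n n ℂ)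
  exact_mod_cast hsq

variable [NeZero D] [NeZero L]

theorem IsDominantEigenpair.exists_isometries {r : ℝ} {ρ : Matrix (Fin D) (Fin D) ℂ}
    (h : IsDominantEigenpair A r ρ) (hA : IsLeftCanonical A) (hB : ∀ j, IsLeftCanonical (B j))
    (hκ : 1 ≤ ‖κ‖) {x : ZMod L → Matrix (Fin D') (Fin D) ℂ} (hx0 : ∃ j, x j ≠ 0)
    (hx : ∀ j, mixedMap (B j) A (x j) = κ • x (j - 1)) :
    ‖κ‖ = 1 ∧ ∃ v : ZMod L → Matrix (Fin D') (Fin D) ℂ,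
      (∀ j, (v j)ᴴ * v j = 1) ∧ ∀ j s, B j s * v j = κ • (v (j - 1) * A s) := by
  have hdet : IsUnit ρ.det := (Matrix.isUnit_iff_isUnit_det ρ).1 h.posDef.isUnit
  set z : ZMod L → Matrix (Fin D') (Fin D) ℂ := fun j => x j * ρ⁻¹
  have hzρ (j : ZMod L) : z j * ρ = x j := Matrix.nonsing_inv_mul_cancel_right _ _ hdet
  have hz0 : ∃ j, z j ≠ 0 := hx0.imp fun j hj h0 => hj (by rw [← hzρ, h0, Matrix.zero_mul])
  obtain ⟨hκ1, hz⟩ := norm_eq_one_and_intertwines h.posDef (h.transferMap_eq hA) hB hκ hz0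
    fun j => by rw [hzρ, hzρ, hx]
  obtain ⟨t, ht⟩ := h.exists_forall_eq_smul_one hA
    (K := fun j => (z j)ᴴ * z j) fun j => sum_conjTranspose_mul_gram_mul (hB j) hκ1 (hz j)
  obtain ⟨a, ha⟩ := exists_smul_isometry_of_gram_eq hz0 ht
  refine ⟨hκ1, fun j => a • z j, ha, fun j s => ?_⟩
  rw [Matrix.mul_smul, hz, Matrix.smul_mul, smul_comm]

end Intertwiners

section Overlaps

variable {d D D' N : ℕ}

theorem prod_ofFn_sum {R ι : Type*} [Semiring R] [Fintype ι] (F : Fin N → ι → R) :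
    (List.ofFn fun i => ∑ t, F i t).prod =
      ∑ t : Fin N → ι, (List.ofFn fun i => F i (t i)).prod := by
  simpa only [MultilinearMap.mkPiAlgebraFin_apply] using
    (MultilinearMap.mkPiAlgebraFin ℕ N R).map_sum F

theorem prod_ofFn_smul {K R : Type*} [CommSemiring K] [Semiring R] [Algebra K R] (c : Fin N → K)
    (F : Fin N → R) :
    (List.ofFn fun i => c i • F i).prod = (∏ i, c i) • (List.ofFn F).prod := by
  simpa only [MultilinearMap.mkPiAlgebraFin_apply] using
    (MultilinearMap.mkPiAlgebraFin K N R).map_smul_univ c F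

theorem prod_ofFn_mul_natCast {R : Type*} [Monoid R] {L : ℕ} (f : ZMod L → R) (k : ℕ) :
    (List.ofFn fun i : Fin (k * L) => f (i : ℕ)).prod = cycleProd f ^ k := by
  have hcell (i : Fin k) : (List.ofFn fun j : Fin L => f ((i * L + j : ℕ))) =
      (List.range L).map fun m : ℕ => f m := by
    simp [← List.map_coe_finRange_eq_range, List.ofFn_eq_map]
  rw [List.ofFn_mul]
  simp only [hcell]
  rw [List.ofFn_const, List.prod_flatten, List.map_replicate, List.prod_replicate, cycleProd]

theorem prod_ofFn_mulLeft_comp_mulRight {m n R : Type*} [Fintype m] [DecidableEq m] [Fintype n]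
    [DecidableEq n] [CommSemiring R] [StarRing R] (P : Fin N → Matrix m m R)
    (Q : Fin N → Matrix n n R) :
    (List.ofFn fun i => (mulLeftLinearMap n R (P i) ∘ₗ mulRightLinearMap m R (Q i)ᴴ :
        Module.End R (Matrix m n R))).prod =
      mulLeftLinearMap n R (List.ofFn P).prod ∘ₗ mulRightLinearMap m R (List.ofFn Q).prodᴴ := by
  induction N with
  | zero => ext1 X; simp
  | succ N ih =>
    rw [List.ofFn_succ, List.prod_cons, ih]
    ext1 X
    simp [List.ofFn_succ, Matrix.mul_assoc]

theorem trace_mulLeft_comp_mulRight {m n R : Type*} [Fintype m] [Fintype n] [CommRing R]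
    (P : Matrix m m R) (Q : Matrix n n R) :
    LinearMap.trace R (Matrix m n R) (mulLeftLinearMap n R P ∘ₗ mulRightLinearMap m R Q) =
      P.trace * Q.trace := by
  classical
  have hrepr (X : Matrix m n R) (i : m) (j : n) :
      (Matrix.stdBasis R m n).repr X (i, j) = X i j := by simp [Matrix.stdBasis]
  rw [LinearMap.trace_eq_matrix_trace R (Matrix.stdBasis R m n), Matrix.trace,
    Fintype.sum_prod_type, Matrix.trace, Matrix.trace, Finset.sum_mul_sum]
  refine Finset.sum_congr rfl fun i _ => Finset.sum_congr rfl fun j _ => ?_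
  rw [Matrix.diag_apply, LinearMap.toMatrix_apply, Matrix.stdBasis_eq_single, hrepr]
  simp [Matrix.mul_apply, Matrix.single_apply, Finset.sum_ite_eq, ite_and]

theorem trace_prod_mixedMap (B : Fin N → MPSTensor d D') (A : Fin N → MPSTensor d D) :
    LinearMap.trace ℂ _ (List.ofFn fun i => mixedMap (B i) (A i)).prod =
      ∑ s : Fin N → Fin d, (List.ofFn fun i => B i (s i)).prod.trace *
        star (List.ofFn fun i => A i (s i)).prod.trace := by
  simp only [mixedMap]
  rw [prod_ofFn_sum, map_sum]
  simp only [prod_ofFn_mulLeft_comp_mulRight, trace_mulLeft_comp_mulRight,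
    Matrix.trace_conjTranspose]

/-- The tensor obtained from `A` by applying the operator `W` to its physical leg. -/
noncomputable def siteAct (W : Matrix (Fin d) (Fin d) ℂ) (A : MPSTensor d D) : MPSTensor d D :=
  fun s => ∑ s', W s s' • A s'

theorem IsLeftCanonical.siteAct {A : MPSTensor d D} (hA : IsLeftCanonical A)
    {W : Matrix (Fin d) (Fin d) ℂ} (hW : Wᴴ * W = 1) : IsLeftCanonical (siteAct W A) := by
  have hentry (a b : Fin d) : ∑ s, star (W s a) * W s b = (1 : Matrix (Fin d) (Fin d) ℂ) a b := by
    simp only [← hW, Matrix.mul_apply, Matrix.conjTranspose_apply]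
  calc ∑ s, (ModulatedMPS.siteAct W A s)ᴴ * ModulatedMPS.siteAct W A s
      = ∑ s, ∑ a, ∑ b, (star (W s a) * W s b) • ((A a)ᴴ * A b) := by
        simp only [ModulatedMPS.siteAct, Matrix.conjTranspose_sum, Matrix.conjTranspose_smul,
          Finset.sum_mul_sum, smul_mul_smul_comm]
    _ = ∑ a, ∑ b, (∑ s, star (W s a) * W s b) • ((A a)ᴴ * A b) := by
        simp only [Finset.sum_smul]
        rw [Finset.sum_comm]
        exact Finset.sum_congr rfl fun a _ => Finset.sum_comm
    _ = ∑ a, (A a)ᴴ * A a := by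
        simp only [hentry, Matrix.one_apply, ite_smul, one_smul, zero_smul, Finset.sum_ite_eq,
          Finset.mem_univ, if_true]
    _ = 1 := hA

theorem tensorOp_mulVec_mpsState (W : Fin N → Matrix (Fin d) (Fin d) ℂ) (A : MPSTensor d D)
    (s : Fin N → Fin d) :
    (tensorOp W *ᵥ mpsState A N) s = (List.ofFn fun i => siteAct (W i) A (s i)).prod.trace := by
  simp only [siteAct]
  rw [prod_ofFn_sum fun i t => W i (s i) t • A t, Matrix.trace_sum]
  simp only [prod_ofFn_smul, Matrix.trace_smul]
  rfl

end Overlaps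

section BondUnitaries

variable {d D L : ℕ} {A : MPSTensor d D}

/-- The on-site operator `W` acts on `A` through the bonds, as `c p† A q`: in `PushThrough`, the
matrices `p` and `q` are the unitaries on the bonds to the left and to the right of the site. -/
def ActsOnBonds (W : Matrix (Fin d) (Fin d) ℂ) (A : MPSTensor d D) (c : ℂ)
    (p q : Matrix (Fin D) (Fin D) ℂ) : Prop :=
  ∀ s, siteAct W A s = c • (pᴴ * A s * q)

theorem trace_cycleProd_mixedMap_pow {V : ZMod L → Matrix (Fin d) (Fin d) ℂ} {k : ℕ} {θ : ℂ}
    (hθ : tensorOp (fun i : Fin (k * L) => V (i : ℕ)) *ᵥ mpsState A (k * L) =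
      θ • mpsState A (k * L)) :
    LinearMap.trace ℂ _ (cycleProd (fun j => mixedMap (siteAct (V j) A) A) ^ k) =
      θ * LinearMap.trace ℂ _ (transferMap A ^ (k * L)) := by
  have hpow : transferMap A ^ (k * L) = (List.ofFn fun _ : Fin (k * L) => mixedMap A A).prod := by
    rw [List.ofFn_const, List.prod_replicate, transferMap_eq_mixedMap]
  have hbra (s : Fin (k * L) → Fin d) :
      (List.ofFn fun i => siteAct (V (i : ℕ)) A (s i)).prod.trace = θ * mpsState A (k * L) s := by
    rw [← tensorOp_mulVec_mpsState (fun i => V (i : ℕ)), hθ, Pi.smul_apply, smul_eq_mul]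
  rw [hpow, ← prod_ofFn_mul_natCast, trace_prod_mixedMap, trace_prod_mixedMap, Finset.mul_sum]
  simp only [hbra, mul_assoc, mpsState]

variable [NeZero D] [NeZero L] {r : ℝ} {ρ : Matrix (Fin D) (Fin D) ℂ}

/-- The overlap of `A` with the transformed state has modulus `‖Tr Eᵏᴸ‖`, which does not tend to
zero. -/
theorem IsDominantEigenpair.exists_hasEigenvalue_cycleProd (h : IsDominantEigenpair A r ρ)
    (hA : IsLeftCanonical A) {V : ZMod L → Matrix (Fin d) (Fin d) ℂ}
    (hV : ∀ k : ℕ, 0 < k → ∃ θ : Circle,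
      tensorOp (fun i : Fin (k * L) => V (i : ℕ)) *ᵥ mpsState A (k * L) =
        (θ : ℂ) • mpsState A (k * L)) :
    ∃ μ, (cycleProd fun j => mixedMap (siteAct (V j) A) A).HasEigenvalue μ ∧ 1 ≤ ‖μ‖ := by
  by_contra! hlt
  obtain ⟨t, ht0, ht⟩ := h.exists_tendsto_trace_pow hA
  have hsub := (ht.comp (tendsto_id.atTop_mul_const' (NeZero.pos L))).norm
  refine norm_ne_zero_iff.2 ht0 (tendsto_nhds_unique hsub ?_)
  refine (norm_zero (E := ℂ) ▸ (tendsto_trace_pow_zero hlt).norm).congr' ?_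
  filter_upwards [eventually_gt_atTop 0] with k hk
  obtain ⟨θ, hθ⟩ := hV k hk
  rw [trace_cycleProd_mixedMap_pow hθ, norm_mul, Circle.norm_coe, one_mul]
  rfl

theorem IsDominantEigenpair.exists_actsOnBonds (h : IsDominantEigenpair A r ρ)
    (hA : IsLeftCanonical A) {V : ZMod L → Matrix.unitaryGroup (Fin d) ℂ}
    (hV : ∀ k : ℕ, 0 < k → ∃ θ : Circle,
      tensorOp (fun i : Fin (k * L) => (V (i : ℕ) : Matrix (Fin d) (Fin d) ℂ)) *ᵥ
        mpsState A (k * L) = (θ : ℂ) • mpsState A (k * L)) :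
    ∃ (c : Circle) (v : ZMod L → Matrix.unitaryGroup (Fin D) ℂ), ∀ j,
      ActsOnBonds (V j : Matrix (Fin d) (Fin d) ℂ) A c (v (j - 1)) (v j) := by
  obtain ⟨μ, hμ, hμ1⟩ :=
    h.exists_hasEigenvalue_cycleProd hA (V := fun j => (V j : Matrix (Fin d) (Fin d) ℂ)) hV
  obtain ⟨κ, rfl⟩ := IsAlgClosed.exists_pow_nat_eq μ (NeZero.pos L)
  have hκ : 1 ≤ ‖κ‖ := by
    rwa [norm_pow, one_le_pow_iff_of_nonneg (norm_nonneg κ) (NeZero.ne L)] at hμ1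
  have hκ0 : κ ≠ 0 := norm_pos_iff.1 (one_pos.trans_le hκ)
  obtain ⟨x, hx0, hx⟩ := exists_cyclic_eigenvectors _ hκ0 hμ
  obtain ⟨hκ1, u, hu, huA⟩ := h.exists_isometries hA
    (fun j => hA.siteAct (Matrix.UnitaryGroup.star_mul_self (V j))) hκ ⟨0, hx0 0⟩ hx
  refine ⟨⟨κ, mem_sphere_zero_iff_norm.2 hκ1⟩,
    fun j => ⟨(u j)ᴴ, Matrix.mem_unitaryGroup_iff.2 ?_⟩, fun j s => ?_⟩
  · rw [Matrix.star_eq_conjTranspose, Matrix.conjTranspose_conjTranspose, hu]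
  · rw [Matrix.conjTranspose_conjTranspose, ← Matrix.smul_mul, ← huA, Matrix.mul_assoc,
      mul_eq_one_comm.1 (hu j), Matrix.mul_one]

theorem exists_pushThrough {G : Type*} {U : ZMod L → G → Matrix.unitaryGroup (Fin d) ℂ}
    (hA : IsInjective A) (hcanon : IsLeftCanonical A) (hsymm : IsSymmetric U A) :
    ∃ v : ZMod L → G → Matrix.unitaryGroup (Fin D) ℂ, PushThrough U A v := by
  obtain ⟨r, ρ, h⟩ := hA.exists_isDominantEigenpair
  have hbond (g : G) := h.exists_actsOnBonds hcanon (V := fun j => U j g) (hsymm g)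
  choose c v hv using hbond
  exact ⟨fun j g => v g j, fun j g => ⟨c g, hv g j⟩⟩

end BondUnitaries

section Rigidity

variable {d D L : ℕ} {A : MPSTensor d D} {r : ℝ} {ρ : Matrix (Fin D) (Fin D) ℂ}

theorem coe_mul_conjTranspose {n : Type*} [Fintype n] [DecidableEq n]
    (P : Matrix.unitaryGroup n ℂ) : (P : Matrix n n ℂ) * (P : Matrix n n ℂ)ᴴ = 1 :=
  Matrix.mem_unitaryGroup_iff.1 P.2

open scoped Matrix.Norms.L2Operator in
theorem norm_eq_one_of_coe_eq_smul_one {n : Type*} [Fintype n] [DecidableEq n] [Nonempty n]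
    {P : Matrix.unitaryGroup n ℂ} {w : ℂ} (hP : (P : Matrix n n ℂ) = w • 1) : ‖w‖ = 1 := by
  rw [← CStarRing.norm_coe_unitary P, hP, norm_smul, norm_one, mul_one]

theorem IsDominantEigenpair.exists_eq_smul_one [NeZero L] (h : IsDominantEigenpair A r ρ)
    {W : ZMod L → Matrix (Fin D) (Fin D) ℂ} {c : ZMod L → Circle}
    (hW : ∀ j s, A s * W j = (c j : ℂ) • (W (j - 1) * A s)) (j : ZMod L) :
    ∃ w : ℂ, W j = w • 1 := by
  have hstep (j : ZMod L) : transferMap A (W j * ρ) = (c j * r : ℂ) • (W (j - 1) * ρ) := by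
    have hterm (s : Fin d) : A s * (W j * ρ) * (A s)ᴴ =
        (c j : ℂ) • (W (j - 1) * (A s * ρ * (A s)ᴴ)) := by
      rw [← Matrix.mul_assoc, hW]
      simp only [Matrix.smul_mul, Matrix.mul_assoc]
    simp only [transferMap_apply, hterm]
    rw [← Finset.smul_sum, ← Finset.mul_sum, ← transferMap_apply, h.apply_eq, Matrix.mul_smul,
      smul_smul]
  have hiter (n : ℕ) (j : ZMod L) : ∃ a : Circle,
      (transferMap A ^ n) (W j * ρ) = (a * r ^ n : ℂ) • (W (j - n) * ρ) := by
    induction n generalizing j with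
    | zero => exact ⟨1, by simp⟩
    | succ n ih =>
      obtain ⟨a, ha⟩ := ih (j - 1)
      refine ⟨c j * a, ?_⟩
      rw [pow_succ, End.mul_apply, hstep, map_smul, ha, smul_smul, Nat.cast_succ, sub_sub,
        add_comm (1 : ZMod L), Circle.coe_mul]
      congr 1
      ring
  obtain ⟨a, ha⟩ := hiter L j
  rw [ZMod.natCast_self, sub_zero] at ha
  obtain ⟨w, hw⟩ := h.exists_eq_smul_of_pow_apply_eq (NeZero.pos L)
    (by rw [norm_mul, Circle.norm_coe, one_mul, norm_pow, Complex.norm_of_nonneg h.pos.le]) ha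
  have hρ : IsUnit ρ := h.posDef.isUnit
  exact ⟨w, hρ.mul_right_cancel (by rw [hw, Matrix.smul_mul, Matrix.one_mul])⟩

variable [NeZero D]

theorem IsDominantEigenpair.exists_ne_zero (h : IsDominantEigenpair A r ρ) : ∃ s, A s ≠ 0 := by
  by_contra! hA
  have hzero : (r : ℂ) • ρ = 0 := by
    rw [← h.apply_eq, transferMap_apply]
    exact Finset.sum_eq_zero fun s _ => by rw [hA s, Matrix.zero_mul, Matrix.zero_mul]
  rcases smul_eq_zero.1 hzero with hr | hρ
  · exact h.pos.ne' (Complex.ofReal_eq_zero.1 hr)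
  · exact h.posDef.isUnit.ne_zero hρ

variable [NeZero L]

theorem IsDominantEigenpair.exists_phases_of_intertwines (h : IsDominantEigenpair A r ρ)
    {W : ZMod L → Matrix.unitaryGroup (Fin D) ℂ} {c : ZMod L → Circle}
    (hW : ∀ j s, A s * W j = (c j : ℂ) • (W (j - 1) * A s)) :
    ∃ w : ZMod L → Circle, ∀ j,
      (W j : Matrix (Fin D) (Fin D) ℂ) = (w j : ℂ) • 1 ∧ w j = c j * w (j - 1) := by
  choose w hw using h.exists_eq_smul_one hW
  have hnorm (j : ZMod L) : ‖w j‖ = 1 := norm_eq_one_of_coe_eq_smul_one (hw j)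
  obtain ⟨s, hs⟩ := h.exists_ne_zero
  refine ⟨fun j => ⟨w j, mem_sphere_zero_iff_norm.2 (hnorm j)⟩, fun j => ⟨hw j, Circle.ext ?_⟩⟩
  have hphase := hW j s
  rw [hw, hw, Matrix.mul_smul, Matrix.mul_one, Matrix.smul_mul, Matrix.one_mul, smul_smul] at hphase
  exact smul_left_injective ℂ hs hphase

/-- Two families of bond unitaries that implement the same on-site operators differ by an
intertwiner of `A` with itself. -/
theorem IsDominantEigenpair.exists_phases_of_actsOnBonds (h : IsDominantEigenpair A r ρ)
    {V : ZMod L → Matrix (Fin d) (Fin d) ℂ} {c c' : ZMod L → Circle}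
    {v v' : ZMod L → Matrix.unitaryGroup (Fin D) ℂ}
    (hv : ∀ j, ActsOnBonds (V j) A (c j) (v (j - 1)) (v j))
    (hv' : ∀ j, ActsOnBonds (V j) A (c' j) (v' (j - 1)) (v' j)) :
    ∃ w : ZMod L → Circle, ∀ j,
      (v j : Matrix (Fin D) (Fin D) ℂ) = (w j : ℂ) • (v' j : Matrix (Fin D) (Fin D) ℂ) ∧
      w j = (c j)⁻¹ * c' j * w (j - 1) := by
  have hW (j : ZMod L) (s : Fin d) :
      A s * (v j * star (v' j) : Matrix.unitaryGroup (Fin D) ℂ) =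
        (((c j)⁻¹ * c' j : Circle) : ℂ) •
          ((v (j - 1) * star (v' (j - 1)) : Matrix.unitaryGroup (Fin D) ℂ) * A s) := by
    have hbonds : A s * v j = (((c j)⁻¹ * c' j : Circle) : ℂ) •
        ((v (j - 1) * (v' (j - 1) : Matrix (Fin D) (Fin D) ℂ)ᴴ) * A s * v' j) := by
      have heq := congrArg (fun M => (c j : ℂ)⁻¹ • ((v (j - 1) : Matrix (Fin D) (Fin D) ℂ) * M))
        ((hv j s).symm.trans (hv' j s))
      simpa only [Matrix.mul_smul, smul_smul, inv_mul_cancel₀ (Circle.coe_ne_zero _), one_smul,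
        ← Matrix.mul_assoc, coe_mul_conjTranspose, Matrix.one_mul, Circle.coe_mul,
        Circle.coe_inv] using heq
    simp only [Submonoid.coe_mul, Unitary.coe_star, ← Matrix.mul_assoc, hbonds, Matrix.smul_mul,
      Matrix.star_eq_conjTranspose]
    simp only [Matrix.mul_assoc, coe_mul_conjTranspose, Matrix.mul_one]
  obtain ⟨w, hw⟩ := h.exists_phases_of_intertwines hW
  refine ⟨w, fun j => ⟨?_, (hw j).2⟩⟩
  rw [← Matrix.one_mul (v' j : Matrix (Fin D) (Fin D) ℂ), ← Matrix.smul_mul, ← (hw j).1]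
  simp [Matrix.mul_assoc]

end Rigidity

section Cocycles

variable {G : Type*} [Group G] {L n : ℕ}

theorem circle_eq_of_smul_coe_eq {m : Type*} [Fintype m] [DecidableEq m] [Nonempty m]
    {a b : Circle} {P : Matrix.unitaryGroup m ℂ}
    (h : (a : ℂ) • (P : Matrix m m ℂ) = (b : ℂ) • (P : Matrix m m ℂ)) : a = b :=
  Circle.ext (smul_left_injective ℂ (Unitary.toUnits P).ne_zero h)

variable [NeZero n] {U : ZMod L → G → Matrix.unitaryGroup (Fin n) ℂ} {ν : ZMod L → G → G → Circle}

theorem IsProjectiveRep.isTwoCocycle (hν : IsProjectiveRep U ν) (j : ZMod L) :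
    IsTwoCocycle (ν j) := by
  intro g h k
  refine circle_eq_of_smul_coe_eq (P := U j (g * h * k)) ?_
  calc ((ν j g h * ν j (g * h) k : Circle) : ℂ) • (U j (g * h * k) : Matrix (Fin n) (Fin n) ℂ)
      = U j g * U j h * U j k := by
        rw [hν, Matrix.smul_mul, hν, smul_smul, Circle.coe_mul]
    _ = U j g * (U j h * U j k) := Matrix.mul_assoc _ _ _
    _ = ((ν j h k * ν j g (h * k) : Circle) : ℂ) •
          (U j (g * h * k) : Matrix (Fin n) (Fin n) ℂ) := by
        rw [hν, Matrix.mul_smul, hν, smul_smul, Circle.coe_mul, mul_assoc g]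

theorem IsProjectiveRep.eqUpToCoboundary {T : MulAut G} (hν : IsProjectiveRep U ν)
    (hU : IsCovariant T U) (j : ZMod L) :
    EqUpToCoboundary (ν j) (fun g h => ν (j - 1) (T g) (T h)) := by
  choose β hβ using hU j
  refine ⟨β, fun g h => ?_⟩
  rw [← mul_assoc, eq_mul_inv_iff_mul_eq]
  refine circle_eq_of_smul_coe_eq (P := U (j - 1) (T (g * h))) ?_
  calc ((ν j g h * β (g * h) : Circle) : ℂ) •
        (U (j - 1) (T (g * h)) : Matrix (Fin n) (Fin n) ℂ)
      = U j g * U j h := by rw [hν, hβ (g * h), smul_smul, Circle.coe_mul]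
    _ = _ := by
        rw [hβ g, hβ h, smul_mul_smul_comm, hν, smul_smul, map_mul]
        simp only [Circle.coe_mul, mul_comm]

end Cocycles

section BondCocycles

variable {G : Type*} {d D L : ℕ} {A : MPSTensor d D}

theorem siteAct_siteAct (V W : Matrix (Fin d) (Fin d) ℂ) (A : MPSTensor d D) :
    siteAct V (siteAct W A) = siteAct (V * W) A := by
  ext1 s
  simp only [siteAct, Matrix.mul_apply, Finset.smul_sum, Finset.sum_smul, smul_smul]
  exact Finset.sum_comm

theorem siteAct_smul_mul_mul (W : Matrix (Fin d) (Fin d) ℂ) (A : MPSTensor d D) (c : ℂ)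
    (P Q : Matrix (Fin D) (Fin D) ℂ) (s : Fin d) :
    siteAct W (fun s => c • (P * A s * Q)) s = c • (P * siteAct W A s * Q) := by
  simp [siteAct, Finset.mul_sum, Finset.sum_mul, Finset.smul_sum, smul_comm c]

theorem ActsOnBonds.smul {W : Matrix (Fin d) (Fin d) ℂ} {c : ℂ} {p q : Matrix (Fin D) (Fin D) ℂ}
    (h : ActsOnBonds W A c p q) (a : ℂ) : ActsOnBonds (a • W) A (a * c) p q := by
  intro s
  rw [mul_smul, ← h s]
  simp [siteAct, Finset.smul_sum, smul_smul]

theorem ActsOnBonds.mul {W W' : Matrix (Fin d) (Fin d) ℂ} {c c' : ℂ}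
    {p q p' q' : Matrix (Fin D) (Fin D) ℂ} (h : ActsOnBonds W A c p q)
    (h' : ActsOnBonds W' A c' p' q') : ActsOnBonds (W * W') A (c * c') (p * p') (q * q') := by
  intro s
  rw [← siteAct_siteAct, funext h', siteAct_smul_mul_mul, h s]
  simp only [Matrix.conjTranspose_mul, Matrix.mul_smul, Matrix.smul_mul, smul_smul,
    Matrix.mul_assoc, mul_comm c]

variable [Group G] [NeZero D] [NeZero L] {T : MulAut G} {r : ℝ} {ρ : Matrix (Fin D) (Fin D) ℂ}
  {U : ZMod L → G → Matrix.unitaryGroup (Fin d) ℂ} {ν : ZMod L → G → G → Circle}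
  {v : ZMod L → G → Matrix.unitaryGroup (Fin D) ℂ}

theorem IsDominantEigenpair.isCovariant (h : IsDominantEigenpair A r ρ) (hU : IsCovariant T U)
    (hv : PushThrough U A v) : IsCovariant T v := by
  intro j g
  choose c hc using hv
  choose a ha using fun j => hU j g
  obtain ⟨w, hw⟩ := h.exists_phases_of_actsOnBonds
    (V := fun j => U j g) (c := fun j => c j g) (v := fun j => v j g)
    (c' := fun j => a j * c (j - 1) (T g)) (v' := fun j => v (j - 1) (T g))
    (fun j => hc j g) (fun j => by
      rw [ha j, Circle.coe_mul]
      exact ActsOnBonds.smul (hc (j - 1) (T g)) _)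
  exact ⟨w j, (hw j).1⟩

theorem IsDominantEigenpair.exists_bond_cocycle (h : IsDominantEigenpair A r ρ)
    (hν : IsProjectiveRep U ν) (hv : PushThrough U A v) :
    ∃ ω : ZMod L → G → G → Circle, IsProjectiveRep v ω ∧
      ∀ j, EqUpToCoboundary (ω j) (fun g h => ν j g h * ω (j - 1) g h) := by
  choose c hc using hv
  have hphase (g k : G) := h.exists_phases_of_actsOnBonds
    (V := fun j => (U j g * U j k : Matrix (Fin d) (Fin d) ℂ))
    (c := fun j => c j g * c j k) (v := fun j => v j g * v j k)
    (c' := fun j => ν j g k * c j (g * k)) (v' := fun j => v j (g * k))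
    (fun j => ActsOnBonds.mul (hc j g) (hc j k)) (fun j => by
      rw [hν, Circle.coe_mul]
      exact ActsOnBonds.smul (hc j (g * k)) _)
  choose ω hω using hphase
  refine ⟨fun j g k => ω g k j, fun j g k => (hω g k j).1,
    fun j => ⟨fun g => (c j g)⁻¹, fun g k => ?_⟩⟩
  simp only [(hω g k j).2, inv_inv, mul_inv]
  ac_rfl

theorem PushThrough.exists_constrained_cocycle (hA : IsInjective A) (hν : IsProjectiveRep U ν)
    (hU : IsCovariant T U) (hv : PushThrough U A v) :
    IsCovariant T v ∧ ∃ ω : ZMod L → G → G → Circle, IsProjectiveRep v ω ∧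
      (∀ j, IsTwoCocycle (ω j)) ∧ SatisfiesConstraints T ν ω := by
  obtain ⟨r, ρ, h⟩ := hA.exists_isDominantEigenpair
  have hcov : IsCovariant T v := h.isCovariant hU hv
  obtain ⟨ω, hω, hων⟩ := h.exists_bond_cocycle hν hv
  exact ⟨hcov, ω, hω, hω.isTwoCocycle, fun j => ⟨hων j, hω.eqUpToCoboundary hcov j⟩⟩

end BondCocycles

section Gauge

variable {d D : ℕ} {A : MPSTensor d D} {a : ℂ} {K : Matrix (Fin D) (Fin D) ℂ}

/-- The gauge transform of `A` by an invertible matrix `K` on the bonds, rescaled by `a`. It changes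
the state on `N` sites only by the factor `a ^ N`. -/
noncomputable def gauge (a : ℂ) (K : Matrix (Fin D) (Fin D) ℂ) (A : MPSTensor d D) :
    MPSTensor d D :=
  fun s => a • (K * A s * K⁻¹)

theorem prod_ofFn_conj {n R : Type*} [Fintype n] [DecidableEq n] [CommRing R] {K : Matrix n n R}
    (hK : IsUnit K.det) {N : ℕ} (F : Fin N → Matrix n n R) :
    (List.ofFn fun i => K * F i * K⁻¹).prod = K * (List.ofFn F).prod * K⁻¹ := by
  induction N with
  | zero => simp [Matrix.mul_nonsing_inv K hK]
  | succ N ih =>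
    rw [List.ofFn_succ, List.prod_cons, ih, List.ofFn_succ, List.prod_cons]
    simp only [Matrix.mul_assoc, Matrix.nonsing_inv_mul_cancel_left _ _ hK]

theorem mpsState_gauge (hK : IsUnit K.det) (N : ℕ) :
    mpsState (gauge a K A) N = a ^ N • mpsState A N := by
  ext s
  simp only [mpsState, gauge, Pi.smul_apply]
  rw [prod_ofFn_smul fun _ => a, prod_ofFn_conj hK fun i => A (s i), Matrix.trace_smul,
    Matrix.trace_mul_comm, Matrix.nonsing_inv_mul_cancel_left _ _ hK, Fin.prod_const]

theorem IsSymmetric.gauge {G : Type*} {L : ℕ} {U : ZMod L → G → Matrix.unitaryGroup (Fin d) ℂ}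
    (hA : IsSymmetric U A) (hK : IsUnit K.det) : IsSymmetric U (gauge a K A) := by
  intro g k hk
  obtain ⟨θ, hθ⟩ := hA g k hk
  exact ⟨θ, by rw [mpsState_gauge hK, Matrix.mulVec_smul, hθ, smul_comm]⟩

theorem IsLeftCanonical.of_gram (hK : IsUnit K.det) {r : ℝ} (ha : ‖a‖ ^ 2 * r = 1)
    (hA : ∑ s, (A s)ᴴ * (Kᴴ * K) * A s = (r : ℂ) • (Kᴴ * K)) : IsLeftCanonical (gauge a K A) := by
  have hterm (s : Fin d) : (gauge a K A s)ᴴ * gauge a K A s =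
      ((‖a‖ ^ 2 : ℝ) : ℂ) • ((Kᴴ)⁻¹ * ((A s)ᴴ * (Kᴴ * K) * A s) * K⁻¹) := by
    simp only [gauge, Matrix.conjTranspose_smul, Matrix.smul_mul, Matrix.mul_smul, smul_smul,
      Complex.star_def, Complex.mul_conj', Complex.ofReal_pow, Matrix.conjTranspose_mul,
      Matrix.conjTranspose_nonsing_inv, Matrix.mul_assoc]
  have hK' : IsUnit Kᴴ.det := Matrix.det_conjTranspose K ▸ hK.star
  rw [IsLeftCanonical, Finset.sum_congr rfl fun s _ => hterm s, ← Finset.smul_sum,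
    ← Finset.sum_mul, ← Finset.mul_sum, hA, Matrix.mul_smul, Matrix.smul_mul, smul_smul,
    ← Complex.ofReal_mul, ha, Complex.ofReal_one, one_smul,
    Matrix.nonsing_inv_mul_cancel_left _ _ hK', Matrix.mul_nonsing_inv _ hK]

theorem transferMap_gauge (hK : IsUnit K.det) (X : Matrix (Fin D) (Fin D) ℂ) :
    transferMap (gauge a K A) (K * X * Kᴴ) =
      ((‖a‖ ^ 2 : ℝ) : ℂ) • (K * transferMap A X * Kᴴ) := by
  have hK' : IsUnit Kᴴ.det := Matrix.det_conjTranspose K ▸ hK.star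
  simp only [transferMap_apply, Finset.mul_sum, Finset.sum_mul, Finset.smul_sum]
  refine Finset.sum_congr rfl fun s _ => ?_
  simp only [gauge, Matrix.conjTranspose_smul, Matrix.smul_mul, Matrix.mul_smul, smul_smul,
    Complex.star_def, Complex.conj_mul', Complex.ofReal_pow, Matrix.conjTranspose_mul,
    Matrix.conjTranspose_nonsing_inv, Matrix.mul_assoc,
    Matrix.nonsing_inv_mul_cancel_left _ _ hK, Matrix.mul_nonsing_inv_cancel_left _ _ hK']

theorem exists_eq_mul_mul_conjTranspose (hK : IsUnit K.det) (X : Matrix (Fin D) (Fin D) ℂ) :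
    ∃ Y, X = K * Y * Kᴴ := by
  have hK' : IsUnit Kᴴ.det := Matrix.det_conjTranspose K ▸ hK.star
  refine ⟨K⁻¹ * X * (Kᴴ)⁻¹, ?_⟩
  simp only [Matrix.mul_assoc, Matrix.mul_nonsing_inv_cancel_left _ _ hK,
    Matrix.nonsing_inv_mul _ hK', Matrix.mul_one]

theorem IsDominantEigenpair.gauge {r : ℝ} {ρ : Matrix (Fin D) (Fin D) ℂ}
    (h : IsDominantEigenpair A r ρ) (ha : a ≠ 0) (hK : IsUnit K.det) :
    IsDominantEigenpair (gauge a K A) (‖a‖ ^ 2 * r) (K * ρ * Kᴴ) where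
  pos := mul_pos (pow_pos (norm_pos_iff.2 ha) 2) h.pos
  posDef := h.posDef.mul_mul_conjTranspose_same
    (Matrix.vecMul_injective_iff_isUnit.2 ((Matrix.isUnit_iff_isUnit_det K).2 hK))
  apply_eq := by
    rw [transferMap_gauge hK, h.apply_eq, Matrix.mul_smul, Matrix.smul_mul, smul_smul,
      Complex.ofReal_mul]
  dominant μ X hX := by
    have hpos : 0 < ‖a‖ ^ 2 := pow_pos (norm_pos_iff.2 ha) 2
    have hne : ((‖a‖ ^ 2 : ℝ) : ℂ) ≠ 0 := Complex.ofReal_ne_zero.2 hpos.ne'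
    obtain ⟨Y, rfl⟩ := exists_eq_mul_mul_conjTranspose hK X
    have hKunit : IsUnit K := (Matrix.isUnit_iff_isUnit_det K).2 hK
    have hY0 : Y ≠ 0 := by
      rintro rfl
      exact hX.2 (by rw [Matrix.mul_zero, Matrix.zero_mul])
    have hY : transferMap A Y = (μ / (‖a‖ ^ 2 : ℝ)) • Y := by
      have hXeq := hX.apply_eq_smul
      rw [transferMap_gauge hK, ← Matrix.smul_mul, ← Matrix.mul_smul, ← Matrix.smul_mul,
        ← Matrix.mul_smul] at hXeq
      have hcancel := hKunit.mul_left_cancel (hKunit.star.mul_right_cancel hXeq)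
      rw [div_eq_inv_mul, mul_smul, ← hcancel, inv_smul_smul₀ hne]
    rcases h.dominant _ Y ⟨End.mem_eigenspace_iff.2 hY, hY0⟩ with ⟨hμ, c, rfl⟩ | hlt
    · refine .inl ⟨?_, c, by rw [Matrix.mul_smul, Matrix.smul_mul]⟩
      rw [Complex.ofReal_mul, ← hμ, mul_div_cancel₀ _ hne]
    · rw [norm_div, Complex.norm_of_nonneg hpos.le, div_lt_iff₀' hpos] at hlt
      exact .inr hlt

theorem IsDominantEigenpair.isInjective {ρ : Matrix (Fin D) (Fin D) ℂ}
    (h : IsDominantEigenpair A 1 ρ) (hA : IsLeftCanonical A) : IsInjective A := by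
  refine ⟨1, one_pos, ρ, 1, h.posDef, Matrix.PosDef.one, h.apply_eq, ?_, h.dominant⟩
  simp only [Matrix.mul_one, Complex.ofReal_one, one_smul]
  exact hA

open scoped MatrixOrder in
theorem exists_conjTranspose_mul_self_eq {n : Type*} [Fintype n] [DecidableEq n]
    {Λ : Matrix n n ℂ} (hΛ : Λ.PosDef) : ∃ K : Matrix n n ℂ, IsUnit K.det ∧ Λ = Kᴴ * K := by
  obtain ⟨K, rfl⟩ := CStarAlgebra.nonneg_iff_eq_star_mul_self.mp hΛ.posSemidef.nonneg
  have hdet := (Matrix.isUnit_iff_isUnit_det _).1 hΛ.isUnit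
  rw [Matrix.det_mul] at hdet
  exact ⟨K, isUnit_of_mul_isUnit_right hdet, rfl⟩

/-- The matrix `K` is a square root of the left eigenvector `Λ = K† K`, which it moves to the
identity. -/
theorem IsInjective.exists_gauge_isLeftCanonical (hA : IsInjective A) :
    ∃ a K, IsUnit K.det ∧ IsInjective (gauge a K A) ∧ IsLeftCanonical (gauge a K A) := by
  obtain ⟨r, hr, ρ, Λ, hρ, hΛ, hfix, hdual, hdom⟩ := hA
  obtain ⟨K, hK, rfl⟩ := exists_conjTranspose_mul_self_eq hΛ
  have ha : ‖(((√r)⁻¹ : ℝ) : ℂ)‖ ^ 2 * r = 1 := by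
    rw [Complex.norm_of_nonneg (inv_nonneg.2 (Real.sqrt_nonneg r)), inv_pow, Real.sq_sqrt hr.le,
      inv_mul_cancel₀ hr.ne']
  have ha0 : (((√r)⁻¹ : ℝ) : ℂ) ≠ 0 := by
    exact_mod_cast inv_ne_zero (Real.sqrt_ne_zero'.2 hr)
  have hcanon := IsLeftCanonical.of_gram hK ha hdual
  have hpair := IsDominantEigenpair.gauge ⟨hr, hρ, hfix, hdom⟩ ha0 hK
  exact ⟨_, K, hK, (ha ▸ hpair).isInjective hcanon, hcanon⟩

end Gauge

end ModulatedMPS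

theorem mainTheorem3_general {G : Type*} [Group G] (L : ℕ) (hL : 0 < L)
    (T : MulAut G) (d : ℕ) (hd : 0 < d)
    (U : ZMod L → G → Matrix.unitaryGroup (Fin d) ℂ)
    (ν : ZMod L → G → G → Circle)
    (hν : ModulatedMPS.IsProjectiveRep U ν)
    (hU : ModulatedMPS.IsCovariant T U) :
    (∀ j : ZMod L, ModulatedMPS.IsTwoCocycle (ν j) ∧
      ModulatedMPS.EqUpToCoboundary (ν j) (fun g h => ν (j - 1) (T g) (T h))) ∧
    (∀ (D : ℕ) (_ : 0 < D) (A : Fin d → Matrix (Fin D) (Fin D) ℂ),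
      ModulatedMPS.IsInjective A →
        (ModulatedMPS.IsLeftCanonical A → ModulatedMPS.IsSymmetric U A →
          ∃ v : ZMod L → G → Matrix.unitaryGroup (Fin D) ℂ, ModulatedMPS.PushThrough U A v) ∧
        ∀ v : ZMod L → G → Matrix.unitaryGroup (Fin D) ℂ, ModulatedMPS.PushThrough U A v →
          ModulatedMPS.IsCovariant T v ∧
          ∃ ω : ZMod L → G → G → Circle,
            ModulatedMPS.IsProjectiveRep v ω ∧
            (∀ j, ModulatedMPS.IsTwoCocycle (ω j)) ∧
            ModulatedMPS.SatisfiesConstraints T ν ω) ∧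
    ((¬ ∃ ω : ZMod L → G → G → Circle, (∀ j, ModulatedMPS.IsTwoCocycle (ω j)) ∧
        ModulatedMPS.SatisfiesConstraints T ν ω) →
      ¬ ∃ (D : ℕ) (_ : 0 < D) (A : Fin d → Matrix (Fin D) (Fin D) ℂ),
        ModulatedMPS.IsInjective A ∧ ModulatedMPS.IsSymmetric U A) := by
  have : NeZero L := ⟨hL.ne'⟩
  have : NeZero d := ⟨hd.ne'⟩
  refine ⟨fun j => ⟨hν.isTwoCocycle j, hν.eqUpToCoboundary hU j⟩, fun D hD A hA => ?_, ?_⟩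
  · have : NeZero D := ⟨hD.ne'⟩
    exact ⟨ModulatedMPS.exists_pushThrough hA,
      fun v hv => hv.exists_constrained_cocycle hA hν hU⟩
  · rintro hno ⟨D, hD, A, hA, hsymm⟩
    have : NeZero D := ⟨hD.ne'⟩
    obtain ⟨a, K, hK, hA', hcanon⟩ := hA.exists_gauge_isLeftCanonical
    obtain ⟨v, hv⟩ := ModulatedMPS.exists_pushThrough hA' hcanon (hsymm.gauge hK)
    obtain ⟨-, ω, -, hω, hconstr⟩ := hv.exists_constrained_cocycle hA' hν hU
    exact hno ⟨ω, hω, hconstr⟩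

theorem mainTheorem3 {G : Type*} [Group G] (L : ℕ) (hL : 0 < L)
    (T : MulAut G) (hT : T ^ L = 1) (d : ℕ) (hd : 0 < d)
    (U : ZMod L → G → Matrix.unitaryGroup (Fin d) ℂ)
    (ν : ZMod L → G → G → Circle)
    (hν : ModulatedMPS.IsProjectiveRep U ν)
    (hU : ModulatedMPS.IsCovariant T U) :
    -- the on-site phases are 2-cocycles, compatible with translation up to coboundaries
    (∀ j : ZMod L, ModulatedMPS.IsTwoCocycle (ν j) ∧
      ModulatedMPS.EqUpToCoboundary (ν j) (fun g h => ν (j - 1) (T g) (T h))) ∧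
    -- a symmetric injective MPS has bond unitaries, and their cocycles satisfy the constraints
    (∀ (D : ℕ) (_ : 0 < D) (A : Fin d → Matrix (Fin D) (Fin D) ℂ),
      ModulatedMPS.IsInjective A → ModulatedMPS.IsLeftCanonical A →
      ModulatedMPS.IsSymmetric U A →
        (∃ v : ZMod L → G → Matrix.unitaryGroup (Fin D) ℂ, ModulatedMPS.PushThrough U A v) ∧
        ∀ v : ZMod L → G → Matrix.unitaryGroup (Fin D) ℂ, ModulatedMPS.PushThrough U A v →
          ModulatedMPS.IsCovariant T v ∧
          ∃ ω : ZMod L → G → G → Circle,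
            ModulatedMPS.IsProjectiveRep v ω ∧
            (∀ j, ModulatedMPS.IsTwoCocycle (ω j)) ∧
            ModulatedMPS.SatisfiesConstraints T ν ω) ∧
    -- LSM-type obstruction
    ((¬ ∃ ω : ZMod L → G → G → Circle, (∀ j, ModulatedMPS.IsTwoCocycle (ω j)) ∧
        ModulatedMPS.SatisfiesConstraints T ν ω) →
      ¬ ∃ (D : ℕ) (_ : 0 < D) (A : Fin d → Matrix (Fin D) (Fin D) ℂ),
        ModulatedMPS.IsInjective A ∧ ModulatedMPS.IsSymmetric U A) := by
  obtain ⟨hsites, hbonds, hLSM⟩ := mainTheorem3_general L hL T d hd U ν hν hU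
  exact ⟨hsites, fun D hD A hA hcanon hsymm =>
    ⟨(hbonds D hD A hA).1 hcanon hsymm, (hbonds D hD A hA).2⟩, hLSM⟩
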